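/- Let $D=D[0,1]$ be the space of functions $x:[0,1]\to\mathbb R$ that are right-continuous and have finite left-hand limits, and put $\|x\|=\sup_{t\in[0,1]}|x(t)|$. Equip $D$ with the Skorokhod topology, generated by the metric $$d(x,y)=\inf_{\lambda\in\Lambda}\Big(\sup_{t}|\lambda(t)-t|\ \vee\ \sup_t|x(t)-y(\lambda(t))|\Big),$$ where $\Lambda$ is the class of strictly increasing continuous maps $\lambda:[0,1]\to[0,1]$ with $\lambda(0)=0$, $\lambda(1)=1$. A set $A\subset D$ is called relatively compact if each sequence in $A$ has a subsequence converging to some element of $D$ (not necessarily in $A$). For $x\in D$ and $T\subset[0,1]$ put $w_x(T)=\sup_{s,t\in T}|x(t)-x(s)|$, and for $\delta\in(0,1)$ put $$w'_x(\delta)=\inf_{\{t_i\}}\max_{1\le i\le v}w_x([t_{i-1},t_i)),\qquad w''_x(\delta)=\sup_{\substack{t_1\le t\le t_2\\ t_2\le t_1+\delta}}\big(|x(t)-x(t_1)|\wedge|x(t_2)-x(t)|\big),$$ where the infimum extends over all finite sets $0=t_0<t_1<\dots<t_v=1$ with $t_i-t_{i-1}>\delta$ for $i=1,\dots,v$, and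 the last supremum over $t_1,t,t_2\in[0,1]$. Let $A\subset D$. (a) $A$ is relatively compact in the Skorokhod topology if and only if (i) $\sup_{x\in A}\|x\|<\infty$, and (ii) $\lim_{\delta\downarrow0}\sup_{x\in A}w'_x(\delta)=0$. (b) $A$ is relatively compact in the Skorokhod topology if and only if (i) holds and (ii$'$) $\lim_{\delta\downarrow0}\sup_{x\in A}w''_x(\delta)=0$, $\ \lim_{\delta\downarrow0}\sup_{x\in A}|x(\delta)-x(0)|=0$, and $\lim_{\delta\downarrow0}\sup_{x\in A}|x(1-)-x(1-\delta)|=0$. (A supremum over the empty set is $0$ here.) -/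

import Mathlib

open Set Filter Topology unitInterval
open scoped ENNReal

/-- The space `D = D[0,1]` of càdlàg functions: real functions on `[0,1]` that are right-continuous
at every point and have a finite left limit at every point. (At `t = 1` the first condition, and at
`t = 0` the second condition, is automatic.) -/
structure SkorokhodD where
  toFun : I → ℝ
  rightContinuous : ∀ t, ContinuousWithinAt toFun (Ici t) t
  exists_leftLim : ∀ t, ∃ l : ℝ, Tendsto toFun (𝓝[<] t) (𝓝 l)

namespace SkorokhodD

instance : CoeFun SkorokhodD fun _ => I → ℝ := ⟨toFun⟩

/-- The class `Λ` of strictly increasing continuous maps `λ : [0,1] → [0,1]` with `λ 0 = 0` and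
`λ 1 = 1`. -/
structure TimeChange where
  toFun : I → I
  strictMono : StrictMono toFun
  continuous : Continuous toFun
  map_zero : toFun 0 = 0
  map_one : toFun 1 = 1

namespace TimeChange

instance : CoeFun TimeChange fun _ => I → I := ⟨toFun⟩

/-- The identity time change. -/
def id : TimeChange := ⟨fun t => t, strictMono_id, continuous_id, rfl, rfl⟩

/-- The composition `t ↦ l (m t)`. -/
def comp (l m : TimeChange) : TimeChange :=
  ⟨fun t => l (m t), l.strictMono.comp m.strictMono, l.continuous.comp m.continuous,
    by rw [m.map_zero, l.map_zero], by rw [m.map_one, l.map_one]⟩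

theorem surjective (l : TimeChange) : Function.Surjective l := by
  intro y
  have h : y ∈ Icc (l 0) (l 1) := by
    rw [l.map_zero, l.map_one]
    exact ⟨unitInterval.nonneg', unitInterval.le_one'⟩
  obtain ⟨t, -, ht⟩ := intermediate_value_Icc (zero_le_one' I) l.continuous.continuousOn h
  exact ⟨t, ht⟩

theorem exists_inverse (l : TimeChange) : ∃ m : TimeChange, ∀ t, l (m t) = t := by
  let e : I ≃o I := l.strictMono.orderIsoOfSurjective l l.surjective
  have he : ∀ t, l (e.symm t) = t := fun t => e.apply_symm_apply t
  refine ⟨⟨e.symm, e.symm.strictMono, e.symm.continuous, ?_, ?_⟩, he⟩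
  · exact l.strictMono.injective ((he 0).trans l.map_zero.symm)
  · exact l.strictMono.injective ((he 1).trans l.map_one.symm)

end TimeChange

/-- The quantity `‖λ - 1‖ ∨ ‖x - yλ‖`, where `‖·‖` is the supremum norm over `[0,1]` (with values
in `[0,∞]`, so that no boundedness has to be known in advance). -/
noncomputable def cost (x y : SkorokhodD) (l : TimeChange) : ℝ≥0∞ :=
  max (⨆ t : I, edist (l t) t) (⨆ t : I, edist (x t) (y (l t)))

/-- The Skorokhod distance `d(x,y) = inf_{λ ∈ Λ} (‖λ - 1‖ ∨ ‖x - yλ‖)`. -/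
noncomputable def skorokhodDist (x y : SkorokhodD) : ℝ≥0∞ := ⨅ l : TimeChange, cost x y l

theorem cost_le_iff {x y : SkorokhodD} {l : TimeChange} {c : ℝ≥0∞} :
    cost x y l ≤ c ↔ (∀ t, edist (l t) t ≤ c) ∧ ∀ t, edist (x t) (y (l t)) ≤ c := by
  simp [cost, iSup_le_iff]

theorem skorokhodDist_self (x : SkorokhodD) : skorokhodDist x x = 0 := by
  refine le_antisymm (iInf_le_of_le TimeChange.id ?_) zero_le
  rw [cost_le_iff]
  exact ⟨fun t => (edist_self t).le, fun t => (edist_self (x t)).le⟩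

theorem skorokhodDist_comm_le (x y : SkorokhodD) : skorokhodDist y x ≤ skorokhodDist x y := by
  refine le_iInf fun l => ?_
  obtain ⟨m, hm⟩ := l.exists_inverse
  obtain ⟨h1, h2⟩ := cost_le_iff.1 (le_refl (cost x y l))
  refine iInf_le_of_le m (cost_le_iff.2 ⟨fun t => ?_, fun t => ?_⟩)
  · have := h1 (m t)
    rwa [hm, edist_comm] at this
  · have := h2 (m t)
    rwa [hm, edist_comm] at this

theorem skorokhodDist_triangle (x y z : SkorokhodD) :
    skorokhodDist x z ≤ skorokhodDist x y + skorokhodDist y z := by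
  refine ENNReal.le_iInf_add_iInf fun l m => ?_
  obtain ⟨h1, h2⟩ := cost_le_iff.1 (le_refl (cost x y l))
  obtain ⟨k1, k2⟩ := cost_le_iff.1 (le_refl (cost y z m))
  refine iInf_le_of_le (m.comp l) (cost_le_iff.2 ⟨fun t => ?_, fun t => ?_⟩)
  · calc edist (m (l t)) t ≤ edist (m (l t)) (l t) + edist (l t) t := edist_triangle _ _ _
      _ ≤ cost y z m + cost x y l := add_le_add (k1 _) (h1 _)
      _ = cost x y l + cost y z m := add_comm _ _
  · exact (edist_triangle _ (y (l t)) _).trans (add_le_add (h2 _) (k2 _))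

theorem eq_of_skorokhodDist_eq_zero {x y : SkorokhodD} (h : skorokhodDist x y = 0) : x = y := by
  have key : ∀ ε : ℝ≥0∞, 0 < ε → ∃ l : TimeChange,
      (∀ t, edist (l t) t < ε) ∧ ∀ t, edist (x t) (y (l t)) < ε := by
    intro ε hε
    obtain ⟨l, hl⟩ := iInf_lt_iff.1 (show skorokhodDist x y < ε by rwa [h])
    obtain ⟨h1, h2⟩ := cost_le_iff.1 (le_refl (cost x y l))
    exact ⟨l, fun t => (h1 t).trans_lt hl, fun t => (h2 t).trans_lt hl⟩
  have hxy : ∀ t, x t = y t := by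
    intro t
    refine eq_of_forall_dist_le fun ε hε => ?_
    have hε3 : 0 < ε / 3 := by positivity
    rcases eq_or_lt_of_le (unitInterval.le_one' (t := t)) with rfl | ht
    · obtain ⟨l, -, h2⟩ := key (ENNReal.ofReal ε) (ENNReal.ofReal_pos.2 hε)
      have := h2 1
      rw [l.map_one, edist_lt_ofReal] at this
      exact this.le
    · obtain ⟨a, ha, hx⟩ := Metric.continuousWithinAt_iff.1 (x.rightContinuous t) (ε / 3) hε3
      obtain ⟨b, hb, hy⟩ := Metric.continuousWithinAt_iff.1 (y.rightContinuous t) (ε / 3) hε3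
      have ht' : 0 < 1 - (t : ℝ) := sub_pos.2 ht
      have ht0 : (0 : ℝ) ≤ t := t.2.1
      obtain ⟨r, hr, hr'⟩ := exists_between (lt_min (lt_min ha hb) ht')
      obtain ⟨hra, hr1⟩ := lt_min_iff.1 hr'
      obtain ⟨hra, hrb⟩ := lt_min_iff.1 hra
      let s : I := ⟨t + r / 2, by linarith, by linarith⟩
      have hs : (s : ℝ) = t + r / 2 := rfl
      obtain ⟨l, h1, h2⟩ := key (ENNReal.ofReal (min (r / 2) (ε / 3)))
        (ENNReal.ofReal_pos.2 (lt_min (by linarith) hε3))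
      have h1 := h1 s
      have h2 := h2 s
      rw [edist_lt_ofReal, lt_min_iff] at h1 h2
      have hl := abs_lt.1 (show |(l s : ℝ) - s| < r / 2 from h1.1)
      have e1 : dist (x s) (x t) < ε / 3 := by
        refine hx (show (t : ℝ) ≤ s by linarith) ?_
        exact abs_lt.2 ⟨by linarith, by linarith⟩
      have e2 : dist (y (l s)) (y t) < ε / 3 := by
        refine hy (show (t : ℝ) ≤ l s by linarith) ?_
        exact abs_lt.2 ⟨by linarith, by linarith⟩
      have e3 := dist_triangle4 (x t) (x s) (y (l s)) (y t)
      rw [dist_comm (x t) (x s)] at e3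
      linarith [h2.2]
  cases x
  cases y
  congr
  exact funext hxy

/-- `D` with the metric `d`; its topology is the Skorokhod topology. -/
noncomputable instance : EMetricSpace SkorokhodD where
  edist := skorokhodDist
  edist_self := skorokhodDist_self
  edist_comm x y := le_antisymm (skorokhodDist_comm_le y x) (skorokhodDist_comm_le x y)
  edist_triangle := skorokhodDist_triangle
  eq_of_edist_eq_zero := eq_of_skorokhodDist_eq_zero

/-- The supremum norm `‖x‖ = sup_{t ∈ [0,1]} |x(t)|`. -/
noncomputable def supNorm (x : SkorokhodD) : ℝ≥0∞ := ⨆ t : I, ‖x t‖ₑ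

/-- The oscillation `w_x(T) = sup_{s,t ∈ T} |x(t) - x(s)|`. -/
noncomputable def osc (x : SkorokhodD) (T : Set I) : ℝ≥0∞ :=
  ⨆ s ∈ T, ⨆ t ∈ T, edist (x t) (x s)

/-- `0 = t_0 < t_1 < … < t_v = 1` is `δ`-sparse: `t_i - t_{i-1} > δ` for `i = 1, …, v`. -/
structure IsSparse (δ : ℝ) {v : ℕ} (t : Fin (v + 1) → I) : Prop where
  strictMono : StrictMono t
  first : t 0 = 0
  last : t (Fin.last v) = 1
  sparse : ∀ i : Fin v, δ < (t i.succ : ℝ) - t i.castSucc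

/-- The càdlàg modulus `w'_x(δ) = inf max_{1 ≤ i ≤ v} w_x[t_{i-1}, t_i)`, the infimum being over
all `δ`-sparse sets. -/
noncomputable def cadlagModulus (x : SkorokhodD) (δ : ℝ) : ℝ≥0∞ :=
  ⨅ (v : ℕ) (t : Fin (v + 1) → I) (_ : IsSparse δ t),
    ⨆ i : Fin v, osc x (Ico (t i.castSucc) (t i.succ))

/-- The modulus `w''_x(δ)`: the supremum of `|x(t) - x(t₁)| ∧ |x(t₂) - x(t)|` over
`t₁ ≤ t ≤ t₂ ≤ t₁ + δ` in `[0,1]`. -/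
noncomputable def cadlagModulus₂ (x : SkorokhodD) (δ : ℝ) : ℝ≥0∞ :=
  ⨆ (t₁ : I) (t₂ : I) (_ : t₁ ≤ t₂) (_ : (t₂ : ℝ) ≤ t₁ + δ) (t : I) (_ : t₁ ≤ t) (_ : t ≤ t₂),
    min (edist (x t) (x t₁)) (edist (x t₂) (x t))

end SkorokhodD

/-- A set is relatively compact if each sequence in it has a convergent subsequence, the limit of
which need not lie in the set. -/
def IsRelativelyCompact {S : Type*} [TopologicalSpace S] (A : Set S) : Prop :=
  ∀ u : ℕ → S, (∀ n, u n ∈ A) →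
    ∃ (a : S) (φ : ℕ → ℕ), StrictMono φ ∧ Tendsto (u ∘ φ) atTop (𝓝 a)

/-! Both criteria reduce to `HasPartition x δ ε`: condition (ii) says that for each `ε` a single `δ`
serves all `x ∈ A`.

Necessity in (a): one function of `D` always has such a partition (`exists_hasPartition`), and
closeness in the Skorokhod metric transfers it at a small loss in `δ` and `ε`
(`HasPartition.of_edist_lt`). A sequence violating boundedness or (ii) therefore cannot have a
convergent subsequence.

Sufficiency in (a): `δ`-sparse partitions have at most `1 / δ` intervals, so along an ultrafilter
their number is constant, and the division points and the values there converge. Piecewise linear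
time changes matching the division points then bring the sequence uniformly within `4ε` of one
element of `D` (`exists_eventually_timeChange_close`). The approximants for different `ε` are
uniformly close to each other, by right-continuity, and so have a uniform limit in `D`; the sequence
converges to it along the ultrafilter.

For (b), smallness of `w''` forbids two large changes within a short time. Large jumps are then far
apart (`add_le_of_lt_jump`), and short intervals without them have small oscillation
(`dist_le_of_forall_jump_le`). A jump near 0 or 1 can escape `w''`, since the function need not
change again on its other side; the two endpoint conditions exclude this. A partition is then built
through the large jumps (`hasPartition_of_modulus₂`). -/

/-! ### Finite sequences and limits at zero -/

theorem Fin.sum_succ_sub_castSucc {v : ℕ} (f : Fin (v + 1) → ℝ) :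
    ∑ i : Fin v, (f i.succ - f i.castSucc) = f (Fin.last v) - f 0 := by
  induction v with
  | zero => simp
  | succ v ih =>
    rw [Fin.sum_univ_castSucc]
    have := ih (fun i => f i.castSucc)
    simp only [Fin.succ_castSucc, Fin.castSucc_zero, Fin.succ_last] at this ⊢
    rw [this]
    ring

/-- A finite sequence running from `a` to `b` has a step that passes over a given `s ∈ [a, b)`. -/
theorem Fin.exists_mem_Ico_castSucc_succ {α : Type*} [LinearOrder α] {v : ℕ}
    (t : Fin (v + 1) → α) {s : α} (h0 : t 0 ≤ s) (h1 : s < t (Fin.last v)) :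
    ∃ i : Fin v, s ∈ Ico (t i.castSucc) (t i.succ) := by
  induction v with
  | zero => exact absurd h1 (not_lt.2 h0)
  | succ v ih =>
    rcases lt_or_ge s (t (Fin.last v).castSucc) with h | h
    · obtain ⟨i, hi⟩ := ih (fun i => t i.castSucc) h0 h
      exact ⟨i.castSucc, hi⟩
    · exact ⟨Fin.last v, h, h1⟩

/-- A chain of `R`-steps from `a` to `b`, as a finite sequence. -/
theorem Relation.ReflTransGen.exists_fin {α : Type*} {R : α → α → Prop} {a b : α}
    (h : Relation.ReflTransGen R a b) :
    ∃ (v : ℕ) (t : Fin (v + 1) → α), t 0 = a ∧ t (Fin.last v) = b ∧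
      ∀ i : Fin v, R (t i.castSucc) (t i.succ) := by
  induction h with
  | refl => exact ⟨0, fun _ => a, rfl, rfl, fun i => i.elim0⟩
  | @tail c d _ hcd ih =>
    obtain ⟨v, t, h0, h1, hR⟩ := ih
    refine ⟨v + 1, Fin.snoc (α := fun _ => α) t d, ?_, ?_, fun i => ?_⟩
    · rw [← Fin.castSucc_zero, Fin.snoc_castSucc, h0]
    · rw [Fin.snoc_last]
    · rw [Fin.snoc_castSucc]
      refine Fin.lastCases ?_ (fun j => ?_) i
      · rw [Fin.succ_last, Fin.snoc_last, h1]
        exact hcd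
      · rw [Fin.succ_castSucc, Fin.snoc_castSucc]
        exact hR j

theorem ENNReal.tendsto_nhds_zero_iff_le_ofReal {α : Type*} {l : Filter α} {f : α → ℝ≥0∞} :
    Tendsto f l (𝓝 0) ↔ ∀ ε : ℝ, 0 < ε → ∀ᶠ a in l, f a ≤ ENNReal.ofReal ε := by
  rw [ENNReal.tendsto_nhds_zero]
  refine ⟨fun h ε hε => h _ (ENNReal.ofReal_pos.2 hε), fun h ε hε => ?_⟩
  obtain ⟨r, hr, hr'⟩ := ENNReal.lt_iff_exists_real_btwn.1 hε
  have hr0 : 0 < r := ENNReal.ofReal_pos.1 hr'.1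
  filter_upwards [h r hr0] with a ha using ha.trans hr'.2.le

theorem unitInterval.eventually_nhdsGT_zero_iff {p : I → Prop} :
    (∀ᶠ s in 𝓝[>] (0 : I), p s) ↔ ∃ δ : ℝ, 0 < δ ∧ ∀ s : I, 0 < s → (s : ℝ) < δ → p s := by
  rw [eventually_nhdsWithin_iff, Metric.eventually_nhds_iff]
  have key : ∀ s : I, dist s 0 = (s : ℝ) := fun s => by
    rw [Subtype.dist_eq, Real.dist_eq]
    simpa using s.2.1
  simp only [key, mem_Ioi]
  exact ⟨fun ⟨δ, h, h'⟩ => ⟨δ, h, fun s h1 h2 => h' h2 h1⟩,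
    fun ⟨δ, h, h'⟩ => ⟨δ, h, fun s h1 h2 => h' s h2 h1⟩⟩

namespace SkorokhodD

/-! ### Sparse partitions, the modulus `w'` and boundedness -/

theorem IsSparse.mono {δ δ' : ℝ} {v : ℕ} {t : Fin (v + 1) → I} (h : IsSparse δ t) (hδ : δ' ≤ δ) :
    IsSparse δ' t :=
  ⟨h.strictMono, h.first, h.last, fun i => hδ.trans_lt (h.sparse i)⟩

theorem IsSparse.exists_mem_Ico {δ : ℝ} {v : ℕ} {t : Fin (v + 1) → I} (h : IsSparse δ t) {s : I}
    (hs : s < 1) : ∃ i : Fin v, s ∈ Ico (t i.castSucc) (t i.succ) :=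
  Fin.exists_mem_Ico_castSucc_succ t (by rw [h.first]; exact unitInterval.nonneg')
    (by rwa [h.last])

/-- The gaps add up to 1. The resulting bound on `v` leaves finitely many sizes of partition in the
compactness argument. -/
theorem IsSparse.natCast_mul_le {δ : ℝ} {v : ℕ} {t : Fin (v + 1) → I} (h : IsSparse δ t) :
    v * δ ≤ 1 := by
  have h1 := Fin.sum_succ_sub_castSucc fun i => (t i : ℝ)
  have h2 : ∑ _i : Fin v, δ ≤ ∑ i : Fin v, ((t i.succ : ℝ) - t i.castSucc) :=
    Finset.sum_le_sum fun i _ => (h.sparse i).le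
  simp only [h.first, h.last] at h1
  rw [h1] at h2
  simpa using h2

theorem exists_isSparse_of_strictMono {v : ℕ} {t : Fin (v + 1) → I} (h : StrictMono t)
    (h0 : t 0 = 0) (h1 : t (Fin.last v) = 1) : ∃ δ : ℝ, 0 < δ ∧ IsSparse δ t := by
  have : ∀ᶠ δ : ℝ in 𝓝[>] 0, ∀ i : Fin v, δ < (t i.succ : ℝ) - t i.castSucc := by
    refine eventually_all.2 fun i => nhdsWithin_le_nhds (eventually_lt_nhds ?_)
    exact sub_pos.2 (h i.castSucc_lt_succ)
  obtain ⟨δ, hδ, hpos⟩ := (this.and self_mem_nhdsWithin).exists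
  exact ⟨δ, hpos, h, h0, h1, hδ⟩

/-- There is a `δ`-sparse set such that `x` oscillates by at most `ε` on each of its intervals. -/
def HasPartition (x : SkorokhodD) (δ ε : ℝ) : Prop :=
  ∃ (v : ℕ) (t : Fin (v + 1) → I), IsSparse δ t ∧ ∀ i : Fin v,
    ∀ s ∈ Ico (t i.castSucc) (t i.succ), ∀ u ∈ Ico (t i.castSucc) (t i.succ),
      dist (x s) (x u) ≤ ε

theorem HasPartition.mono {x : SkorokhodD} {δ δ' ε : ℝ} (h : x.HasPartition δ ε) (hδ : δ' ≤ δ) :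
    x.HasPartition δ' ε := by
  obtain ⟨v, t, ht, h⟩ := h
  exact ⟨v, t, ht.mono hδ, h⟩

theorem osc_le_ofReal_iff {x : SkorokhodD} {T : Set I} {ε : ℝ} (hε : 0 ≤ ε) :
    x.osc T ≤ ENNReal.ofReal ε ↔ ∀ s ∈ T, ∀ u ∈ T, dist (x s) (x u) ≤ ε := by
  simp only [osc, iSup_le_iff, edist_le_ofReal hε]
  exact ⟨fun h s hs u hu => h u hu s hs, fun h s hs u hu => h u hu s hs⟩

theorem HasPartition.cadlagModulus_le {x : SkorokhodD} {δ ε : ℝ} (hε : 0 ≤ ε)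
    (h : x.HasPartition δ ε) : x.cadlagModulus δ ≤ ENNReal.ofReal ε := by
  obtain ⟨v, t, ht, h⟩ := h
  exact iInf_le_of_le v (iInf_le_of_le t (iInf_le_of_le ht
    (iSup_le fun i => (osc_le_ofReal_iff hε).2 (h i))))

theorem hasPartition_of_cadlagModulus_lt {x : SkorokhodD} {δ ε : ℝ} (hε : 0 ≤ ε)
    (h : x.cadlagModulus δ < ENNReal.ofReal ε) : x.HasPartition δ ε := by
  simp only [cadlagModulus, iInf_lt_iff] at h
  obtain ⟨v, t, ht, h⟩ := h
  exact ⟨v, t, ht, fun i => (osc_le_ofReal_iff hε).1 ((le_iSup _ i).trans h.le)⟩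

theorem tendsto_cadlagModulus_iff {A : Set SkorokhodD} :
    Tendsto (fun δ : ℝ => ⨆ x ∈ A, x.cadlagModulus δ) (𝓝[>] 0) (𝓝 0) ↔
      ∀ ε : ℝ, 0 < ε → ∃ δ : ℝ, 0 < δ ∧ ∀ x ∈ A, x.HasPartition δ ε := by
  rw [ENNReal.tendsto_nhds_zero_iff_le_ofReal]
  constructor
  · intro h ε hε
    -- Halving `ε` yields a strict inequality, needed because the infimum defining `w'` need not be
    -- attained.
    obtain ⟨δ, hδ, hpos⟩ := ((h (ε / 2) (half_pos hε)).and self_mem_nhdsWithin).exists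
    refine ⟨δ, hpos, fun x hx => hasPartition_of_cadlagModulus_lt hε.le ?_⟩
    refine (le_iSup₂ (f := fun x (_ : x ∈ A) => x.cadlagModulus δ) x hx).trans_lt ?_
    exact hδ.trans_lt ((ENNReal.ofReal_lt_ofReal_iff hε).2 (half_lt_self hε))
  · intro h ε hε
    obtain ⟨δ, hδ, h⟩ := h ε hε
    filter_upwards [Ioo_mem_nhdsGT hδ] with δ' hδ'
    exact iSup₂_le fun x hx => ((h x hx).mono hδ'.2.le).cadlagModulus_le hε.le

/-- Every element of `D` oscillates little on the intervals of some partition of `[0, 1]`. -/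
theorem exists_hasPartition (x : SkorokhodD) {ε : ℝ} (hε : 0 < ε) :
    ∃ δ : ℝ, 0 < δ ∧ x.HasPartition δ ε := by
  let R : I → I → Prop := fun a b =>
    a < b ∧ ∀ s ∈ Ico a b, ∀ u ∈ Ico a b, dist (x s) (x u) ≤ ε
  suffices h : Relation.ReflTransGen R 0 1 by
    obtain ⟨v, t, h0, h1, hR⟩ := h.exists_fin
    obtain ⟨δ, hδ, ht⟩ := exists_isSparse_of_strictMono
      (Fin.strictMono_iff_lt_succ.2 fun i => (hR i).1) h0 h1
    exact ⟨δ, hδ, v, t, ht, fun i => (hR i).2⟩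
  -- The supremum of the points reachable from 0 is itself reachable, by the left limit there; were
  -- it below 1, right-continuity would allow one more step.
  set S : Set I := {s | Relation.ReflTransGen R 0 s} with hS
  have h0S : (0 : I) ∈ S := Relation.ReflTransGen.refl
  have hc : sSup S ∈ S := by
    rcases eq_or_lt_of_le (unitInterval.nonneg' (t := sSup S)) with h | h
    · rwa [← h]
    obtain ⟨l, hl⟩ := x.exists_leftLim (sSup S)
    have hl' := hl (Metric.ball_mem_nhds l (half_pos hε))
    obtain ⟨a, ha, hal⟩ := (mem_nhdsLT_iff_exists_Ioo_subset' h).1 hl'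
    obtain ⟨s, hs, has⟩ := lt_sSup_iff.1 (show a < sSup S from ha)
    rcases eq_or_lt_of_le (le_sSup hs) with hs' | hs'
    · rwa [← hs']
    refine Relation.ReflTransGen.tail hs ⟨hs', fun p hp q hq => ?_⟩
    have e1 : dist (x p) l < ε / 2 := hal ⟨has.trans_le hp.1, hp.2⟩
    have e2 : dist (x q) l < ε / 2 := hal ⟨has.trans_le hq.1, hq.2⟩
    have := dist_triangle_right (x p) (x q) l
    linarith
  rcases eq_or_lt_of_le (unitInterval.le_one' (t := sSup S)) with h | h
  · rw [h] at hc
    exact hc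
  exfalso
  have hr := x.rightContinuous (sSup S) (Metric.ball_mem_nhds _ (half_pos hε))
  obtain ⟨b, hb, hbr⟩ := (mem_nhdsGE_iff_exists_Ico_subset' h).1 hr
  have hbS : b ∈ S := by
    refine Relation.ReflTransGen.tail hc ⟨hb, fun p hp q hq => ?_⟩
    have e1 : dist (x p) (x (sSup S)) < ε / 2 := hbr hp
    have e2 : dist (x q) (x (sSup S)) < ε / 2 := hbr hq
    have := dist_triangle_right (x p) (x q) (x (sSup S))
    linarith
  exact absurd (le_sSup hbS) (not_le.2 hb)

theorem exists_forall_abs_le (x : SkorokhodD) : ∃ M : ℝ, ∀ t, |x t| ≤ M := by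
  obtain ⟨δ, -, v, t, ht, h⟩ := x.exists_hasPartition one_pos
  refine ⟨∑ i, |x (t i)| + 1, fun s => ?_⟩
  have hle : ∀ i, |x (t i)| ≤ ∑ i, |x (t i)| := fun i =>
    Finset.single_le_sum (f := fun i => |x (t i)|) (fun i _ => abs_nonneg _) (Finset.mem_univ i)
  rcases eq_or_lt_of_le (unitInterval.le_one' (t := s)) with rfl | hs
  · have := hle (Fin.last v)
    rw [ht.last] at this
    linarith
  · obtain ⟨i, hi⟩ := ht.exists_mem_Ico hs
    have h1 := h i s hi (t i.castSucc) ⟨le_rfl, hi.1.trans_lt hi.2⟩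
    rw [Real.dist_eq] at h1
    have h2 := abs_sub_abs_le_abs_sub (x s) (x (t i.castSucc))
    linarith [hle i.castSucc]

theorem iSup_supNorm_lt_top_iff {A : Set SkorokhodD} :
    (⨆ x ∈ A, x.supNorm) < ∞ ↔ ∃ M : ℝ, ∀ x ∈ A, ∀ t, |x t| ≤ M := by
  constructor
  · intro h
    refine ⟨(⨆ x ∈ A, x.supNorm).toReal, fun x hx t => ?_⟩
    have h1 : ‖x t‖ₑ ≤ ⨆ x ∈ A, x.supNorm :=
      (le_iSup (fun t => ‖x t‖ₑ) t).trans (le_iSup₂ (f := fun x (_ : x ∈ A) => x.supNorm) x hx)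
    have h2 := ENNReal.toReal_mono h.ne h1
    rwa [toReal_enorm, Real.norm_eq_abs] at h2
  · rintro ⟨M, hM⟩
    refine lt_of_le_of_lt (iSup₂_le fun x hx => iSup_le fun t => ?_) (ENNReal.ofReal_lt_top (r := M))
    rw [← ofReal_norm, Real.norm_eq_abs]
    exact ENNReal.ofReal_le_ofReal (hM x hx t)

/-! ### Time changes and necessity in (a) -/

/-- Composition with a time change. -/
def compTimeChange (x : SkorokhodD) (l : TimeChange) : SkorokhodD where
  toFun t := x (l t)
  rightContinuous t := (x.rightContinuous (l t)).comp l.continuous.continuousWithinAt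
    fun _ hs => l.strictMono.monotone hs
  exists_leftLim t := by
    obtain ⟨a, ha⟩ := x.exists_leftLim (l t)
    exact ⟨a, ha.comp (tendsto_nhdsWithin_iff.2 ⟨l.continuous.continuousWithinAt,
      eventually_nhdsWithin_of_forall fun _ hs => l.strictMono hs⟩)⟩

theorem edist_le_ofReal_of_timeChange {x y : SkorokhodD} {ε : ℝ} (hε : 0 ≤ ε) (l : TimeChange)
    (h1 : ∀ t, dist (l t) t ≤ ε) (h2 : ∀ t, dist (x t) (y (l t)) ≤ ε) :
    edist x y ≤ ENNReal.ofReal ε :=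
  iInf_le_of_le l (cost_le_iff.2 ⟨fun t => (edist_le_ofReal hε).2 (h1 t),
    fun t => (edist_le_ofReal hε).2 (h2 t)⟩)

theorem exists_timeChange_of_edist_lt {x y : SkorokhodD} {ε : ℝ}
    (h : edist x y < ENNReal.ofReal ε) :
    ∃ l : TimeChange, (∀ t, dist (l t) t < ε) ∧ ∀ t, dist (x t) (y (l t)) < ε := by
  obtain ⟨l, hl⟩ := iInf_lt_iff.1 (show skorokhodDist x y < _ from h)
  obtain ⟨h1, h2⟩ := cost_le_iff.1 (le_refl (cost x y l))
  exact ⟨l, fun t => edist_lt_ofReal.1 ((h1 t).trans_lt hl),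
    fun t => edist_lt_ofReal.1 ((h2 t).trans_lt hl)⟩

/-- The division points of `a` are pulled back by the inverse time change. Each moves by less than
`η`, so a gap loses at most `2 * η`; two values of `x` are each within `η` of values of `a` on one
interval. -/
theorem HasPartition.of_edist_lt {x a : SkorokhodD} {δ ε η : ℝ} (ha : a.HasPartition δ ε)
    (h : edist x a < ENNReal.ofReal η) : x.HasPartition (δ - 2 * η) (ε + 2 * η) := by
  obtain ⟨v, t, ht, hosc⟩ := ha
  obtain ⟨l, hl, hxa⟩ := exists_timeChange_of_edist_lt h
  obtain ⟨m, hm⟩ := l.exists_inverse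
  have hmd : ∀ s : I, |(s : ℝ) - m s| < η := fun s => by
    have := hl (m s)
    rwa [hm] at this
  refine ⟨v, fun i => m (t i), ⟨m.strictMono.comp ht.strictMono, ?_, ?_, fun i => ?_⟩, ?_⟩
  · rw [ht.first, m.map_zero]
  · rw [ht.last, m.map_one]
  · have h1 := abs_lt.1 (hmd (t i.succ))
    have h2 := abs_lt.1 (hmd (t i.castSucc))
    linarith [ht.sparse i]
  · intro i
    have key : ∀ s ∈ Ico (m (t i.castSucc)) (m (t i.succ)),
        l s ∈ Ico (t i.castSucc) (t i.succ) := fun s hs => by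
      have h1 := l.strictMono.monotone hs.1
      have h2 := l.strictMono hs.2
      rw [hm] at h1 h2
      exact ⟨h1, h2⟩
    intro s hs u hu
    have h1 := hosc i _ (key s hs) _ (key u hu)
    have h2 := hxa s
    have h3 := hxa u
    rw [dist_comm] at h3
    have h4 := dist_triangle4 (x s) (a (l s)) (a (l u)) (x u)
    linarith

theorem IsRelativelyCompact.exists_forall_abs_le {A : Set SkorokhodD}
    (hA : IsRelativelyCompact A) : ∃ M : ℝ, ∀ x ∈ A, ∀ t, |x t| ≤ M := by
  by_contra! h
  choose u huA s hs using fun n : ℕ => h n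
  obtain ⟨a, φ, hφ, hlim⟩ := hA u huA
  obtain ⟨M, hM⟩ := a.exists_forall_abs_le
  have h1 : ∀ᶠ k in atTop, edist ((u ∘ φ) k) a < ENNReal.ofReal 1 :=
    hlim (Metric.eball_mem_nhds a (ENNReal.ofReal_pos.2 one_pos))
  obtain ⟨N, hN⟩ := exists_nat_ge (M + 1)
  obtain ⟨k, hk, hkN⟩ := (h1.and (eventually_ge_atTop N)).exists
  obtain ⟨l, -, hl⟩ := exists_timeChange_of_edist_lt hk
  have h2 := hl (s (φ k))
  have h3 := hM (l (s (φ k)))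
  have h4 := hs (φ k)
  have h5 : (N : ℝ) ≤ φ k := Nat.cast_le.2 (hkN.trans (hφ.id_le k))
  rw [Real.dist_eq] at h2
  have h6 := abs_sub_abs_le_abs_sub ((u ∘ φ) k (s (φ k))) (a (l (s (φ k))))
  simp only [Function.comp_apply] at h2 h6
  linarith

theorem IsRelativelyCompact.exists_forall_hasPartition {A : Set SkorokhodD}
    (hA : IsRelativelyCompact A) {ε : ℝ} (hε : 0 < ε) :
    ∃ δ : ℝ, 0 < δ ∧ ∀ x ∈ A, x.HasPartition δ ε := by
  by_contra! h
  choose u huA hu using fun n : ℕ => h (1 / ((n : ℝ) + 1)) Nat.one_div_pos_of_nat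
  obtain ⟨a, φ, hφ, hlim⟩ := hA u huA
  obtain ⟨δ, hδ, ha⟩ := a.exists_hasPartition (half_pos hε)
  -- This choice makes `δ - 2 * η ≥ δ / 2` and `ε / 2 + 2 * η ≤ ε`, so the partition of the limit
  -- contradicts the choice of `u (φ k)` for large `k`.
  set η := min (δ / 4) (ε / 4) with hη
  have hη0 : 0 < η := lt_min (by linarith) (by linarith)
  have hη1 : η ≤ δ / 4 := min_le_left _ _
  have hη2 : η ≤ ε / 4 := min_le_right _ _
  have h1 : ∀ᶠ k in atTop, edist ((u ∘ φ) k) a < ENNReal.ofReal η :=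
    hlim (Metric.eball_mem_nhds a (ENNReal.ofReal_pos.2 hη0))
  have h2 : ∀ᶠ k in atTop, 1 / ((φ k : ℝ) + 1) < δ / 2 :=
    (tendsto_one_div_add_atTop_nhds_zero_nat.comp hφ.tendsto_atTop).eventually
      (eventually_lt_nhds (half_pos hδ))
  obtain ⟨k, hk1, hk2⟩ := (h1.and h2).exists
  obtain ⟨v, t, ht, hosc⟩ := ha.of_edist_lt hk1
  exact hu (φ k) ⟨v, t, ht.mono (by linarith), fun i s hs p hp =>
    (hosc i s hs p hp).trans (by linarith)⟩

/-! ### Sufficiency in (a) -/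

/-- The piecewise linear time change that carries one partition to another. -/
theorem TimeChange.exists_of_partitions {v : ℕ} {s t : Fin (v + 1) → I} (hs : StrictMono s)
    (ht : StrictMono t) (hs0 : s 0 = 0) (hs1 : s (Fin.last v) = 1) (ht0 : t 0 = 0)
    (ht1 : t (Fin.last v) = 1) :
    ∃ l : TimeChange, (∀ i, l (s i) = t i) ∧ ∀ u, dist (l u) u ≤ ∑ i : Fin v,
      |((t i.succ : ℝ) - t i.castSucc) - ((s i.succ : ℝ) - s i.castSucc)| := by
  have hΔs : ∀ i : Fin v, 0 < (s i.succ : ℝ) - s i.castSucc := fun i =>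
    sub_pos.2 (hs i.castSucc_lt_succ)
  have hΔt : ∀ i : Fin v, 0 < (t i.succ : ℝ) - t i.castSucc := fun i =>
    sub_pos.2 (ht i.castSucc_lt_succ)
  -- For `u` in `[0,1]`, `c i u` is the fraction of the `i`-th interval of `s` lying to the left of
  -- `u`. The identity is the sum of the `c i` weighted by the gaps of `s`; weighting by the gaps of
  -- `t` gives the time change, and `0 ≤ c i ≤ 1` bounds the displacement.
  let c : Fin v → ℝ → ℝ := fun i u =>
    (min u (s i.succ) - min u (s i.castSucc)) / (s i.succ - s i.castSucc)
  have hcont : ∀ i, Continuous (c i) := fun i => by fun_prop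
  have hmono : ∀ i, Monotone (c i) := fun i p q hpq => by
    refine div_le_div_of_nonneg_right ?_ (hΔs i).le
    have := hΔs i
    rcases min_cases p (s i.succ : ℝ) with ⟨h1, h1'⟩ | ⟨h1, h1'⟩ <;>
    rcases min_cases q (s i.succ : ℝ) with ⟨h2, h2'⟩ | ⟨h2, h2'⟩ <;>
    rcases min_cases p (s i.castSucc : ℝ) with ⟨h3, h3'⟩ | ⟨h3, h3'⟩ <;>
    rcases min_cases q (s i.castSucc : ℝ) with ⟨h4, h4'⟩ | ⟨h4, h4'⟩ <;>
    linarith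
  have hc0 : ∀ i, ∀ u, 0 ≤ c i u := fun i u =>
    div_nonneg (sub_nonneg.2 (min_le_min_left _ (sub_pos.1 (hΔs i)).le)) (hΔs i).le
  have hc1 : ∀ i, ∀ u, c i u ≤ 1 := fun i u => by
    refine (div_le_one (hΔs i)).2 ?_
    have := hΔs i
    rcases min_cases u (s i.succ : ℝ) with ⟨h1, h1'⟩ | ⟨h1, h1'⟩ <;>
    rcases min_cases u (s i.castSucc : ℝ) with ⟨h3, h3'⟩ | ⟨h3, h3'⟩ <;>
    linarith
  have hid : ∀ u : I, ∑ i, ((s i.succ : ℝ) - s i.castSucc) * c i u = u := fun u => by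
    have h1 : ∀ i : Fin v, ((s i.succ : ℝ) - s i.castSucc) * c i u =
        min (u : ℝ) (s i.succ) - min (u : ℝ) (s i.castSucc) := fun i =>
      mul_div_cancel₀ _ (hΔs i).ne'
    rw [Finset.sum_congr rfl fun i _ => h1 i,
      Fin.sum_succ_sub_castSucc fun i => min (u : ℝ) (s i), hs0, hs1]
    simp [u.2.1, u.2.2]
  let L : ℝ → ℝ := fun u => ∑ i, ((t i.succ : ℝ) - t i.castSucc) * c i u
  have hLs : ∀ j, L (s j) = t j := fun j => by
    have h1 : ∀ i : Fin v, ((t i.succ : ℝ) - t i.castSucc) * c i (s j) =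
        (t (min i.succ j) : ℝ) - t (min i.castSucc j) := fun i => by
      have h := hΔs i
      rcases lt_or_ge i.castSucc j with hij | hij
      · have hij' : i.succ ≤ j := Fin.castSucc_lt_iff_succ_le.1 hij
        have e1 : (s i.succ : ℝ) ≤ s j := hs.monotone hij'
        have e2 : (s i.castSucc : ℝ) ≤ s j := hs.monotone hij.le
        simp only [c, min_eq_right e1, min_eq_right e2, div_self h.ne', mul_one,
          min_eq_left hij', min_eq_left hij.le]
      · have hij' : j ≤ i.succ := hij.trans i.castSucc_lt_succ.le
        have e1 : (s j : ℝ) ≤ s i.succ := hs.monotone hij'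
        have e2 : (s j : ℝ) ≤ s i.castSucc := hs.monotone hij
        simp only [c, min_eq_left e1, min_eq_left e2, min_eq_right hij', min_eq_right hij,
          sub_self, zero_div, mul_zero]
    simp only [L]
    rw [Finset.sum_congr rfl fun i _ => h1 i,
      Fin.sum_succ_sub_castSucc fun i => (t (min i j) : ℝ)]
    simp [min_eq_right (Fin.le_last j), ht0]
  have hLmono : ∀ p q : I, p < q → L p < L q := fun p q hpq => by
    refine Finset.sum_lt_sum
      (fun i _ => mul_le_mul_of_nonneg_left (hmono i hpq.le) (hΔt i).le) ?_
    -- If no `c i` increased strictly from `p` to `q`, neither would their combination that equals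
    -- the identity.
    by_contra! h
    have h1 : ∑ i, ((s i.succ : ℝ) - s i.castSucc) * c i q ≤
        ∑ i, ((s i.succ : ℝ) - s i.castSucc) * c i p := Finset.sum_le_sum fun i hi =>
      mul_le_mul_of_nonneg_left (le_of_mul_le_mul_left (h i hi) (hΔt i)) (hΔs i).le
    rw [hid, hid] at h1
    exact absurd hpq (not_lt.2 h1)
  have hL0 : L 0 = 0 := by simpa [hs0, ht0] using hLs 0
  have hL1 : L 1 = 1 := by simpa [hs1, ht1] using hLs (Fin.last v)
  have hLm : ∀ p q : I, p ≤ q → L p ≤ L q := fun p q hpq => by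
    rcases hpq.eq_or_lt with rfl | h
    · rfl
    · exact (hLmono p q h).le
  have hLI : ∀ u : I, L u ∈ I := fun u =>
    ⟨by simpa [hL0] using hLm 0 u unitInterval.nonneg',
      by simpa [hL1] using hLm u 1 unitInterval.le_one'⟩
  have hLc : Continuous L :=
    continuous_finsetSum _ fun i _ => continuous_const.mul (hcont i)
  refine ⟨⟨fun u => ⟨L u, hLI u⟩, fun p q hpq => hLmono p q hpq,
    (hLc.comp continuous_subtype_val).subtype_mk _, Subtype.ext hL0, Subtype.ext hL1⟩,
    fun i => Subtype.ext (hLs i), fun u => ?_⟩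
  change |L u - (u : ℝ)| ≤ _
  have h1 : L u - u = ∑ i : Fin v, (((t i.succ : ℝ) - t i.castSucc) -
      ((s i.succ : ℝ) - s i.castSucc)) * c i u := by
    have h2 := hid u
    simp only [sub_mul, Finset.sum_sub_distrib, L] at h2 ⊢
    linarith
  rw [h1]
  refine (Finset.abs_sum_le_sum_abs _ _).trans (Finset.sum_le_sum fun i _ => ?_)
  rw [abs_mul, abs_of_nonneg (hc0 i u)]
  exact mul_le_of_le_one_right (abs_nonneg _) (hc1 i u)

/-- A bounded sequence with a common modulus comes, along an ultrafilter and up to time changes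
that tend to the identity, uniformly close to a single element of `D`. -/
theorem exists_eventually_timeChange_close (U : Ultrafilter ℕ) {x : ℕ → SkorokhodD} {M δ ε : ℝ}
    (hM : ∀ n t, |x n t| ≤ M) (hδ : 0 < δ) (hε : 0 < ε) (hx : ∀ n, (x n).HasPartition δ ε) :
    ∃ z : SkorokhodD, ∀ η : ℝ, 0 < η → ∀ᶠ n in (U : Filter ℕ), ∃ l : TimeChange,
      (∀ t, dist (l t) t ≤ η) ∧ ∀ t, dist (x n t) (z (l t)) ≤ 4 * ε := by
  obtain ⟨N, hN⟩ := exists_nat_ge (1 / δ)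
  have h1 : ∀ᶠ n in (U : Filter ℕ), ∃ v ∈ Iic N, ∃ t : Fin (v + 1) → I, IsSparse δ t ∧
      ∀ i : Fin v, ∀ s ∈ Ico (t i.castSucc) (t i.succ), ∀ u ∈ Ico (t i.castSucc) (t i.succ),
        dist (x n s) (x n u) ≤ ε := by
    refine Eventually.of_forall fun n => ?_
    obtain ⟨v, t, ht, h⟩ := hx n
    refine ⟨v, ?_, t, ht, h⟩
    have h2 : (v : ℝ) ≤ N := ((le_div_iff₀ hδ).2 ht.natCast_mul_le).trans hN
    exact Nat.cast_le.1 h2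
  -- An ultrafilter selects one of finitely many alternatives, so a single `v` serves almost all
  -- `n`.
  obtain ⟨v, -, hv⟩ := (Ultrafilter.eventually_exists_mem_iff (finite_Iic N)).1 h1
  obtain ⟨τ, hτ⟩ := hv.choice
  obtain ⟨t, ht⟩ : ∃ t, Tendsto τ U (𝓝 t) := ⟨_, (U.map τ).le_nhds_lim⟩
  obtain ⟨y, -, hy⟩ := (isCompact_univ_pi fun _ : Fin (v + 1) =>
      isCompact_Icc (a := -M) (b := M)).ultrafilter_le_nhds (U.map fun n i => x n (τ n i))
    (by
      rw [Ultrafilter.coe_map, le_principal_iff, mem_map]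
      exact univ_mem' fun n i _ => abs_le.1 (hM n _))
  have ht' : ∀ i, Tendsto (fun n => (τ n i : ℝ)) U (𝓝 (t i)) := fun i =>
    (continuous_subtype_val.tendsto _).comp (tendsto_pi_nhds.1 ht i)
  have hy' : ∀ᶠ n in (U : Filter ℕ), ∀ i, dist (x n (τ n i)) (y i) < ε := eventually_all.2 fun i =>
    (tendsto_pi_nhds.1 (show Tendsto (fun n i => x n (τ n i)) U (𝓝 y) from hy) i)
      (Metric.ball_mem_nhds _ hε)
  have ht0 : t 0 = 0 := tendsto_nhds_unique (tendsto_pi_nhds.1 ht 0)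
    (tendsto_const_nhds.congr' (hτ.mono fun n hn => hn.1.first.symm))
  have ht1 : t (Fin.last v) = 1 := tendsto_nhds_unique (tendsto_pi_nhds.1 ht (Fin.last v))
    (tendsto_const_nhds.congr' (hτ.mono fun n hn => hn.1.last.symm))
  -- In the limit the gaps are only known to be `≥ δ`; this suffices to keep the points distinct.
  have htm : StrictMono t := Fin.strictMono_iff_lt_succ.2 fun i => by
    have : δ ≤ (t i.succ : ℝ) - t i.castSucc :=
      ge_of_tendsto ((ht' i.succ).sub (ht' i.castSucc)) (hτ.mono fun n hn => (hn.1.sparse i).le)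
    exact Subtype.coe_lt_coe.1 (by linarith)
  -- The approximant is one member `x m` of the sequence itself, with its division points moved to
  -- the limit points `t` by `k`. The bound `4 * ε` is `ε` within an interval of `x n`, `2 * ε`
  -- between corresponding division points, and `ε` within an interval of `x m`.
  obtain ⟨m, ⟨hmp, hmo⟩, hmy⟩ := (hτ.and hy').exists
  obtain ⟨k, hk, -⟩ := TimeChange.exists_of_partitions htm hmp.strictMono ht0 ht1 hmp.first hmp.last
  refine ⟨(x m).compTimeChange k, fun η hη => ?_⟩
  have hsum : Tendsto (fun n => ∑ i : Fin v, |((t i.succ : ℝ) - t i.castSucc) -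
      ((τ n i.succ : ℝ) - τ n i.castSucc)|) U (𝓝 0) := by
    have := tendsto_finsetSum (Finset.univ : Finset (Fin v)) fun i _ =>
      ((tendsto_const_nhds (x := (t i.succ : ℝ) - t i.castSucc)).sub
        ((ht' i.succ).sub (ht' i.castSucc))).abs
    simpa using this
  filter_upwards [hτ, hy', hsum.eventually (eventually_lt_nhds hη)] with n ⟨hnp, hno⟩ hny hnη
  obtain ⟨l, hl, hlη⟩ :=
    TimeChange.exists_of_partitions hnp.strictMono htm hnp.first hnp.last ht0 ht1
  refine ⟨l, fun s => (hlη s).trans hnη.le, fun s => ?_⟩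
  change dist (x n s) (x m (k (l s))) ≤ 4 * ε
  have hnode : ∀ i, dist (x n (τ n i)) (x m (τ m i)) < 2 * ε := fun i => by
    have := dist_triangle_right (x n (τ n i)) (x m (τ m i)) (y i)
    linarith [hny i, hmy i]
  -- The point 1 lies in none of the half-open intervals; there the values at the last division
  -- points are compared.
  rcases eq_or_lt_of_le (unitInterval.le_one' (t := s)) with rfl | hs
  · have := hnode (Fin.last v)
    rw [hnp.last, hmp.last] at this
    rw [l.map_one, k.map_one]
    linarith
  · obtain ⟨i, hi⟩ := hnp.exists_mem_Ico hs
    have hki : k (l s) ∈ Ico (τ m i.castSucc) (τ m i.succ) := by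
      rw [← hk, ← hk, ← hl, ← hl]
      exact ⟨k.strictMono.monotone (l.strictMono.monotone hi.1), k.strictMono (l.strictMono hi.2)⟩
    have e1 := hno i s hi _ ⟨le_rfl, hi.1.trans_lt hi.2⟩
    have e2 := hmo i _ ⟨le_rfl, hki.1.trans_lt hki.2⟩ _ hki
    have e3 := dist_triangle4 (x n s) (x n (τ n i.castSucc)) (x m (τ m i.castSucc)) (x m (k (l s)))
    linarith [hnode i.castSucc]

/-- If a sequence of functions is close, up to arbitrarily small time changes, to both `y` and `z`,
then `y` and `z` are uniformly close. -/
theorem dist_le_of_frequently_timeChange_close {y z : SkorokhodD} {a b : ℝ}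
    (h : ∀ η : ℝ, 0 < η → ∃ (x : SkorokhodD) (l m : TimeChange),
      (∀ t, dist (l t) t ≤ η) ∧ (∀ t, dist (m t) t ≤ η) ∧
      (∀ t, dist (x t) (y (l t)) ≤ a) ∧ ∀ t, dist (x t) (z (m t)) ≤ b) (t : I) :
    dist (y t) (z t) ≤ a + b := by
  rcases eq_or_lt_of_le (unitInterval.le_one' (t := t)) with rfl | ht
  · obtain ⟨x, l, m, -, -, hy, hz⟩ := h 1 one_pos
    have h1 := hy 1
    have h2 := hz 1
    rw [l.map_one] at h1
    rw [m.map_one] at h2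
    have := dist_triangle_left (y 1) (z 1) (x 1)
    linarith
  refine le_of_forall_pos_le_add fun ε hε => ?_
  have hy := y.rightContinuous t (Metric.ball_mem_nhds _ (half_pos hε))
  have hz := z.rightContinuous t (Metric.ball_mem_nhds _ (half_pos hε))
  obtain ⟨c, hc, hcr⟩ := (mem_nhdsGE_iff_exists_Ico_subset' ht).1 (inter_mem hy hz)
  have hc' : (t : ℝ) < c := hc
  have hc1 : (c : ℝ) ≤ 1 := c.2.2
  have ht0 : (0 : ℝ) ≤ t := t.2.1
  -- At the midpoint of `[t, c)`, time changes moving points by at most a quarter of its length stay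
  -- inside it, where `y` and `z` are within `ε / 2` of their values at `t`.
  let s : I := ⟨t + (c - t) / 2, by linarith, by linarith⟩
  have hs : (s : ℝ) = t + (c - t) / 2 := rfl
  obtain ⟨x, l, m, hl, hm, hxy, hxz⟩ := h ((c - t) / 4) (by linarith)
  have hmem : ∀ r : I, dist r s ≤ (c - t) / 4 → r ∈ Ico t c := fun r hr => by
    have := abs_le.1 (show |(r : ℝ) - s| ≤ _ from hr)
    exact ⟨show (t : ℝ) ≤ r by linarith, show (r : ℝ) < c by linarith⟩
  have e1 : dist (y (l s)) (y t) < ε / 2 := (hcr (hmem _ (hl s))).1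
  have e2 : dist (z (m s)) (z t) < ε / 2 := (hcr (hmem _ (hm s))).2
  have e3 := dist_triangle_left (y (l s)) (z (m s)) (x s)
  have e4 := dist_triangle4 (y t) (y (l s)) (z (m s)) (z t)
  rw [dist_comm (y t) (y (l s))] at e4
  linarith [hxy s, hxz s]

/-- `D` is closed under uniform approximation. -/
theorem exists_uniform_limit {z : ℕ → SkorokhodD} {r : ℕ → ℝ} (hr : Tendsto r atTop (𝓝 0))
    (hz : ∀ j k t, dist (z j t) (z k t) ≤ r j + r k) :
    ∃ y : SkorokhodD, ∀ k t, dist (z k t) (y t) ≤ r k := by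
  have hlim : ∀ t, ∃ a, Tendsto (fun k => z k t) atTop (𝓝 a) := fun t => by
    refine cauchySeq_tendsto_of_complete (Metric.cauchySeq_iff'.2 fun ε hε => ?_)
    obtain ⟨N, hN⟩ := (hr.eventually (eventually_lt_nhds (half_pos hε))).exists_forall_of_atTop
    exact ⟨N, fun n hn => by linarith [hz n N t, hN n hn, hN N le_rfl]⟩
  choose y hy using hlim
  have hzy : ∀ k t, dist (z k t) (y t) ≤ r k := fun k t => by
    have h1 : Tendsto (fun j => dist (z k t) (z j t)) atTop (𝓝 (dist (z k t) (y t))) :=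
      tendsto_const_nhds.dist (hy t)
    have h2 : Tendsto (fun j => r k + r j) atTop (𝓝 (r k)) := by
      simpa using tendsto_const_nhds.add hr
    exact le_of_tendsto_of_tendsto' h1 h2 fun j => hz k j t
  have hsmall : ∀ ε : ℝ, 0 < ε → ∃ k, r k < ε := fun ε hε =>
    (hr.eventually (eventually_lt_nhds hε)).exists
  refine ⟨⟨y, fun t => ?_, fun t => ?_⟩, hzy⟩
  · refine Metric.tendsto_nhds.2 fun ε hε => ?_
    obtain ⟨k, hk⟩ := hsmall (ε / 3) (by linarith)
    filter_upwards [(z k).rightContinuous t (Metric.ball_mem_nhds _ (show 0 < ε / 3 by linarith))]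
      with s hs
    have hs' : dist (z k s) (z k t) < ε / 3 := hs
    have h1 := dist_triangle4 (y s) (z k s) (z k t) (y t)
    rw [dist_comm (y s) (z k s)] at h1
    linarith [hzy k s, hzy k t]
  · rcases (𝓝[<] t).eq_or_neBot with h | h
    · exact ⟨0, by rw [h]; exact tendsto_bot⟩
    refine cauchy_map_iff_exists_tendsto.1 (Metric.cauchy_iff.2 ⟨inferInstance, fun ε hε => ?_⟩)
    obtain ⟨k, hk⟩ := hsmall (ε / 4) (by linarith)
    obtain ⟨a, ha⟩ := (z k).exists_leftLim t
    refine ⟨y '' ((z k) ⁻¹' Metric.ball a (ε / 4)),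
      image_mem_map (ha (Metric.ball_mem_nhds _ (by linarith))), ?_⟩
    rintro _ ⟨p, hp, rfl⟩ _ ⟨q, hq, rfl⟩
    have hp' : dist (z k p) a < ε / 4 := hp
    have hq' : dist (z k q) a < ε / 4 := hq
    have h1 := dist_triangle_left (y p) a (z k p)
    have h2 := dist_triangle_left (y q) a (z k q)
    have h3 := dist_triangle_right (y p) (y q) a
    linarith [hzy k p, hzy k q]

/-- One ultrafilter serves all precisions `r k`. For any two of them, almost all `u n` are close to
both approximants, so the approximants are uniformly close to each other. -/
theorem isRelativelyCompact_of_hasPartition {A : Set SkorokhodD} {M : ℝ}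
    (hM : ∀ x ∈ A, ∀ t, |x t| ≤ M)
    (hA : ∀ ε : ℝ, 0 < ε → ∃ δ : ℝ, 0 < δ ∧ ∀ x ∈ A, x.HasPartition δ ε) :
    IsRelativelyCompact A := by
  intro u hu
  let U : Ultrafilter ℕ := hyperfilter ℕ
  let r : ℕ → ℝ := fun k => 4 * (1 / ((k : ℝ) + 1))
  have hr : Tendsto r atTop (𝓝 0) := by
    simpa [r] using (tendsto_one_div_add_atTop_nhds_zero_nat (𝕜 := ℝ)).const_mul 4
  have hstep : ∀ k : ℕ, ∃ z : SkorokhodD, ∀ η : ℝ, 0 < η → ∀ᶠ n in (U : Filter ℕ),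
      ∃ l : TimeChange, (∀ t, dist (l t) t ≤ η) ∧ ∀ t, dist (u n t) (z (l t)) ≤ r k := fun k => by
    have hk : (0 : ℝ) < 1 / ((k : ℝ) + 1) := Nat.one_div_pos_of_nat
    obtain ⟨δ, hδ, h⟩ := hA _ hk
    exact exists_eventually_timeChange_close U (fun n => hM _ (hu n)) hδ hk fun n => h _ (hu n)
  choose z hz using hstep
  obtain ⟨y, hy⟩ := exists_uniform_limit hr fun j k t =>
    dist_le_of_frequently_timeChange_close (fun η hη => by
      obtain ⟨n, ⟨l, hl, hl'⟩, m, hm, hm'⟩ := ((hz j η hη).and (hz k η hη)).exists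
      exact ⟨u n, l, m, hl, hm, hl', hm'⟩) t
  have hlim : Tendsto u U (𝓝 y) := by
    refine EMetric.tendsto_nhds.2 fun ε hε => ?_
    obtain ⟨e, he, he'⟩ := ENNReal.lt_iff_exists_real_btwn.1 hε
    have he0 : 0 < e := ENNReal.ofReal_pos.1 he'.1
    obtain ⟨k, hk⟩ := (hr.eventually (eventually_lt_nhds (half_pos he0))).exists
    filter_upwards [hz k e he0] with n ⟨l, hl, hl'⟩
    refine (edist_le_ofReal_of_timeChange he l hl fun t => ?_).trans_lt he'.2
    have := dist_triangle (u n t) (z k (l t)) (y (l t))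
    linarith [hl' t, hy k (l t)]
  -- A limit along a nonprincipal ultrafilter is a cluster point of the sequence, hence in a metric
  -- space the limit of a subsequence.
  have hcl : MapClusterPt y atTop u := by
    refine hlim.mapClusterPt.mono ?_
    rw [← Nat.cofinite_eq_atTop]
    exact hyperfilter_le_cofinite
  obtain ⟨φ, hφ, h⟩ := hcl.tendsto_subseq
  exact ⟨y, φ, hφ, h⟩

theorem isRelativelyCompact_iff_hasPartition {A : Set SkorokhodD} :
    IsRelativelyCompact A ↔ (∃ M : ℝ, ∀ x ∈ A, ∀ t, |x t| ≤ M) ∧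
      ∀ ε : ℝ, 0 < ε → ∃ δ : ℝ, 0 < δ ∧ ∀ x ∈ A, x.HasPartition δ ε :=
  ⟨fun h => ⟨IsRelativelyCompact.exists_forall_abs_le h,
    fun _ hε => IsRelativelyCompact.exists_forall_hasPartition h hε⟩,
    fun ⟨⟨_, hM⟩, h⟩ => isRelativelyCompact_of_hasPartition hM h⟩

/-! ### Left limits and the conditions of (b) in real terms -/

theorem tendsto_leftLim (x : SkorokhodD) (t : I) :
    Tendsto x (𝓝[<] t) (𝓝 (Function.leftLim x t)) := by
  rcases (𝓝[<] t).eq_or_neBot with h | h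
  · rw [h]
    exact tendsto_bot
  · obtain ⟨l, hl⟩ := x.exists_leftLim t
    rwa [leftLim_eq_of_tendsto hl]

theorem dist_leftLim_le (x : SkorokhodD) {a t : I} (hat : a < t) {y c : ℝ}
    (h : ∀ s ∈ Ioo a t, dist (x s) y ≤ c) : dist (Function.leftLim x t) y ≤ c := by
  have : (𝓝[<] t).NeBot := nhdsLT_neBot_of_exists_lt ⟨a, hat⟩
  refine le_of_tendsto ((x.tendsto_leftLim t).dist tendsto_const_nhds) ?_
  filter_upwards [Ioo_mem_nhdsLT hat] with s hs using h s hs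

theorem exists_lt_dist_of_lt_dist_leftLim (x : SkorokhodD) {a t : I} (hat : a < t) {y c : ℝ}
    (h : c < dist (Function.leftLim x t) y) : ∃ s ∈ Ioo a t, c < dist (x s) y := by
  by_contra! hc
  exact absurd h (not_lt.2 (x.dist_leftLim_le hat hc))

theorem tendsto_cadlagModulus₂_iff {A : Set SkorokhodD} :
    Tendsto (fun δ : ℝ => ⨆ x ∈ A, x.cadlagModulus₂ δ) (𝓝[>] 0) (𝓝 0) ↔
      ∀ ε : ℝ, 0 < ε → ∃ δ : ℝ, 0 < δ ∧ ∀ x ∈ A, ∀ t₁ t t₂ : I, t₁ ≤ t → t ≤ t₂ →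
        (t₂ : ℝ) ≤ t₁ + δ → dist (x t) (x t₁) ≤ ε ∨ dist (x t₂) (x t) ≤ ε := by
  rw [ENNReal.tendsto_nhds_zero_iff_le_ofReal]
  refine forall₂_congr fun ε hε => ?_
  simp only [cadlagModulus₂, iSup_le_iff, min_le_iff, edist_le_ofReal hε.le]
  constructor
  · intro h
    obtain ⟨δ, h, hδ⟩ := (h.and self_mem_nhdsWithin).exists
    exact ⟨δ, hδ, fun x hx t₁ t t₂ h1 h2 h3 => h x hx t₁ t₂ (h1.trans h2) h3 t h1 h2⟩
  · rintro ⟨δ, hδ, h⟩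
    filter_upwards [Ioo_mem_nhdsGT hδ] with δ' hδ' x hx t₁ t₂ _ h3 t h1 h2
    exact h x hx t₁ t t₂ h1 h2 (by linarith [hδ'.2])

theorem tendsto_edist_zero_iff {A : Set SkorokhodD} :
    Tendsto (fun δ : I => ⨆ x ∈ A, edist (x δ) (x 0)) (𝓝[>] 0) (𝓝 0) ↔
      ∀ ε : ℝ, 0 < ε → ∃ δ : ℝ, 0 < δ ∧ ∀ x ∈ A, ∀ s : I, 0 < s → (s : ℝ) < δ →
        dist (x s) (x 0) ≤ ε := by
  rw [ENNReal.tendsto_nhds_zero_iff_le_ofReal]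
  refine forall₂_congr fun ε hε => ?_
  simp only [unitInterval.eventually_nhdsGT_zero_iff, iSup_le_iff, edist_le_ofReal hε.le]
  exact exists_congr fun δ => and_congr_right fun _ =>
    ⟨fun h x hx s h1 h2 => h s h1 h2 x hx, fun h s h1 h2 x hx => h x hx s h1 h2⟩

theorem tendsto_edist_leftLim_one_iff {A : Set SkorokhodD} :
    Tendsto (fun δ : I => ⨆ x ∈ A, edist (Function.leftLim x 1) (x (σ δ))) (𝓝[>] 0) (𝓝 0) ↔
      ∀ ε : ℝ, 0 < ε → ∃ δ : ℝ, 0 < δ ∧ ∀ x ∈ A, ∀ s : I, s < 1 → 1 - δ < (s : ℝ) →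
        dist (x s) (Function.leftLim x 1) ≤ ε := by
  rw [ENNReal.tendsto_nhds_zero_iff_le_ofReal]
  refine forall₂_congr fun ε hε => ?_
  simp only [unitInterval.eventually_nhdsGT_zero_iff, iSup_le_iff, edist_le_ofReal hε.le]
  refine exists_congr fun δ => and_congr_right fun _ => ⟨fun h x hx s h1 h2 => ?_,
    fun h s h1 h2 x hx => ?_⟩
  · have h1' : (s : ℝ) < 1 := h1
    have := h (σ s) (show (0 : ℝ) < σ s by rw [unitInterval.coe_symm_eq]; linarith)
      (by rw [unitInterval.coe_symm_eq]; linarith) x hx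
    rwa [unitInterval.symm_symm, dist_comm] at this
  · have h1' : (0 : ℝ) < s := h1
    rw [dist_comm]
    exact h x hx (σ s) (show (σ s : ℝ) < 1 by rw [unitInterval.coe_symm_eq]; linarith)
      (by rw [unitInterval.coe_symm_eq]; linarith)

/-! ### Comparison of partitions with `w''` and the endpoint conditions -/

section

variable {x : SkorokhodD} {δ ε : ℝ}

/-- An interval of length at most `δ` contains at most one division point, so `t` shares its
partition interval with `t₁` or with `t₂`. -/
theorem HasPartition.dist_le_or_dist_le (h : x.HasPartition δ ε) (hε : 0 ≤ ε) {t₁ t t₂ : I}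
    (h1 : t₁ ≤ t) (h2 : t ≤ t₂) (h3 : (t₂ : ℝ) ≤ t₁ + δ) :
    dist (x t) (x t₁) ≤ ε ∨ dist (x t₂) (x t) ≤ ε := by
  obtain ⟨v, p, hp, h⟩ := h
  rcases eq_or_lt_of_le (unitInterval.le_one' (t := t)) with rfl | ht
  · right
    rw [le_antisymm unitInterval.le_one' h2, dist_self]
    exact hε
  obtain ⟨i, hi⟩ := hp.exists_mem_Ico ht
  rcases le_or_gt (p i.castSucc) t₁ with h4 | h4
  · exact Or.inl (h i t hi t₁ ⟨h4, h1.trans_lt hi.2⟩)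
  · refine Or.inr (h i t₂ ⟨hi.1.trans h2, show (t₂ : ℝ) < p i.succ from ?_⟩ t hi)
    have h5 : (t₁ : ℝ) < p i.castSucc := h4
    linarith [hp.sparse i]

theorem HasPartition.dist_zero_le (h : x.HasPartition δ ε) {s : I} (hs : (s : ℝ) < δ) :
    dist (x s) (x 0) ≤ ε := by
  obtain ⟨v, p, hp, h⟩ := h
  obtain ⟨i, hi⟩ := hp.exists_mem_Ico (zero_lt_one' I)
  refine h i s ⟨hi.1.trans unitInterval.nonneg', show (s : ℝ) < p i.succ from ?_⟩ 0 hi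
  have h1 : (0 : ℝ) ≤ p i.castSucc := (p i.castSucc).2.1
  linarith [hp.sparse i]

theorem HasPartition.dist_leftLim_one_le (h : x.HasPartition δ ε) {s : I} (hs1 : s < 1)
    (hs : 1 - δ < (s : ℝ)) : dist (x s) (Function.leftLim x 1) ≤ ε := by
  obtain ⟨v, p, hp, h⟩ := h
  obtain ⟨i, hi⟩ := hp.exists_mem_Ico hs1
  -- Otherwise a further partition interval, longer than `δ`, would fit between `s > 1 - δ` and 1.
  have hlast : p i.succ = 1 := by
    by_contra hne
    have hlt : p i.succ < 1 := lt_of_le_of_ne unitInterval.le_one' hne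
    obtain ⟨j, hj⟩ := hp.exists_mem_Ico hlt
    have h1 : (s : ℝ) < p i.succ := hi.2
    have h2 : i.succ ≤ j.castSucc := by
      have : i.succ < j.succ := hp.strictMono.lt_iff_lt.1 hj.2
      exact Fin.le_castSucc_iff.2 this
    have h3 : (p i.succ : ℝ) ≤ p j.castSucc := hp.strictMono.monotone h2
    have h4 : (p j.succ : ℝ) ≤ 1 := (p j.succ).2.2
    linarith [hp.sparse j]
  rw [dist_comm]
  rw [hlast] at hi
  refine x.dist_leftLim_le hs1 fun u hu => ?_
  have h2 := h i
  rw [hlast] at h2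
  exact h2 u ⟨hi.1.trans hu.1.le, hu.2⟩ s hi

/-- An interval of length at most `δ` without jumps exceeding `2ε` has small oscillation. -/
theorem dist_le_of_forall_jump_le (hε : 0 < ε)
    (hw : ∀ t₁ t t₂ : I, t₁ ≤ t → t ≤ t₂ → (t₂ : ℝ) ≤ t₁ + δ →
      dist (x t) (x t₁) ≤ ε ∨ dist (x t₂) (x t) ≤ ε)
    {a b : I} (hab : (b : ℝ) ≤ a + δ)
    (hjump : ∀ s ∈ Ioo a b, dist (Function.leftLim x s) (x s) ≤ 2 * ε) :
    ∀ s ∈ Ico a b, ∀ u ∈ Ico a b, dist (x s) (x u) ≤ 10 * ε := by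
  suffices key : ∀ s ∈ Ico a b, dist (x s) (x a) ≤ 5 * ε by
    intro s hs u hu
    linarith [dist_triangle_right (x s) (x u) (x a), key s hs, key u hu]
  -- Let `c = sInf S`. Before `c` the function is within `2ε` of `x a`; the jump at `c` is at most
  -- `2ε`; after `c`, applying `hw` to `a`, a point of `S` close to `c`, and `u` keeps `x u` within
  -- `ε` of `x c`. The total is `5ε`.
  set S : Set I := {s | s ∈ Ico a b ∧ 2 * ε < dist (x s) (x a)} with hS
  by_contra! hne
  obtain ⟨q, hq, hqε⟩ := hne
  have hqS : q ∈ S := ⟨hq, by linarith⟩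
  have hac : a ≤ sInf S := le_sInf fun s hs => hs.1.1
  have hcb : sInf S < b := (sInf_le hqS).trans_lt hq.2
  have hleft : ∀ s, a ≤ s → s < sInf S → dist (x s) (x a) ≤ 2 * ε := fun s h1 h2 => by
    by_contra! h3
    exact absurd (sInf_le (show s ∈ S from ⟨⟨h1, h2.trans hcb⟩, h3⟩)) (not_le.2 h2)
  have hright : ∀ u, sInf S ≤ u → u < b → dist (x u) (x (sInf S)) ≤ ε := fun u h1 h2 => by
    rcases h1.eq_or_lt with rfl | h1
    · rw [dist_self]
      exact hε.le
    refine le_of_forall_pos_le_add fun η hη => ?_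
    have hr := x.rightContinuous (sInf S) (Metric.ball_mem_nhds _ hη)
    obtain ⟨e, he, her⟩ := (mem_nhdsGE_iff_exists_Ico_subset' h1).1 hr
    obtain ⟨s, hs, hse⟩ := sInf_lt_iff.1 (lt_min (show sInf S < e from he) h1)
    obtain ⟨hse, hsu⟩ := lt_min_iff.1 hse
    have e1 : dist (x s) (x (sInf S)) < η := her ⟨sInf_le hs, hse⟩
    have h2' : (u : ℝ) < b := h2
    have e2 : dist (x u) (x s) ≤ ε := (hw a s u hs.1.1 hsu.le (by linarith)).resolve_left
      (by linarith [hs.2])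
    linarith [dist_triangle (x u) (x s) (x (sInf S))]
  have h1 := hright q (sInf_le hqS) hq.2
  rcases hac.eq_or_lt with hac | hac
  · rw [← hac] at h1
    linarith
  · have h2 := hjump _ ⟨hac, hcb⟩
    have h3 : dist (Function.leftLim x (sInf S)) (x a) ≤ 2 * ε :=
      x.dist_leftLim_le hac fun s hs => hleft s hs.1.le hs.2
    have h4 := dist_triangle (x q) (x (sInf S)) (x a)
    have h5 := dist_triangle_left (x (sInf S)) (x a) (Function.leftLim x (sInf S))
    linarith

/-- Jumps exceeding `2ε` are far apart. -/
theorem add_le_of_lt_jump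
    (hw : ∀ t₁ t t₂ : I, t₁ ≤ t → t ≤ t₂ → (t₂ : ℝ) ≤ t₁ + δ →
      dist (x t) (x t₁) ≤ ε ∨ dist (x t₂) (x t) ≤ ε) (hε : 0 < ε) {s u : I} (hs0 : 0 < s)
    (hsu : s < u) (hs : 2 * ε < dist (Function.leftLim x s) (x s))
    (hu : 2 * ε < dist (Function.leftLim x u) (x u)) : (s : ℝ) + δ ≤ u := by
  by_contra! hlt
  obtain ⟨r, hr, hrε⟩ := x.exists_lt_dist_of_lt_dist_leftLim hsu hu
  have hs0' : (0 : ℝ) < s := hs0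
  have hs1 : (s : ℝ) ≤ 1 := s.2.2
  -- A point `q` in `(c, s)` sees the jump at `s` and is within `δ` of `u`. Then `hw` forces both `x
  -- u` and `x r` to within `ε` of `x s`, whereas `x r` and `x u` differ by more than `2ε`.
  let c : I := ⟨max 0 (u - δ), le_max_left _ _, max_le zero_le_one (by linarith)⟩
  have hcs : c < s := show max (0 : ℝ) (u - δ) < s from max_lt hs0' (by linarith)
  obtain ⟨q, hq, hqε⟩ := x.exists_lt_dist_of_lt_dist_leftLim hcs hs
  have hq' : (u : ℝ) - δ < q := (le_max_right _ _).trans_lt (show (c : ℝ) < q from hq.1)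
  have hru : (r : ℝ) < u := hr.2
  rw [dist_comm] at hqε
  have e1 := (hw q s u hq.2.le hsu.le (by linarith)).resolve_left (by linarith)
  have e2 := (hw q s r hq.2.le hr.1.le (by linarith)).resolve_left (by linarith)
  linarith [dist_triangle_right (x r) (x u) (x s)]

/-- Large jumps and the point 1 must be division points; they are at least `δ` apart and at least
`δ` from 0. The gaps between them are filled by steps of length between `δ / 3` and `2δ / 3`, which
exceeds `δ / 4` strictly, as sparsity demands. -/
theorem hasPartition_of_modulus₂ (hδ : 0 < δ) (hδ1 : δ ≤ 1) (hε : 0 < ε)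
    (hw : ∀ t₁ t t₂ : I, t₁ ≤ t → t ≤ t₂ → (t₂ : ℝ) ≤ t₁ + δ →
      dist (x t) (x t₁) ≤ ε ∨ dist (x t₂) (x t) ≤ ε)
    (h0 : ∀ s : I, 0 < s → (s : ℝ) < δ → dist (x s) (x 0) ≤ ε)
    (h1 : ∀ s : I, s < 1 → 1 - δ < (s : ℝ) → dist (x s) (Function.leftLim x 1) ≤ ε) :
    x.HasPartition (δ / 4) (10 * ε) := by
  let J : I → Prop := fun s => 0 < s ∧ 2 * ε < dist (Function.leftLim x s) (x s)
  have hJ0 : ∀ s, J s → δ ≤ s := fun s hs => by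
    by_contra! hlt
    have e1 := h0 s hs.1 hlt
    have e2 : dist (Function.leftLim x s) (x 0) ≤ ε := x.dist_leftLim_le hs.1 fun u hu =>
      h0 u hu.1 ((show (u : ℝ) < s from hu.2).trans hlt)
    linarith [dist_triangle_right (Function.leftLim x s) (x s) (x 0), hs.2]
  have hJ1 : ∀ s, J s → s < 1 → (s : ℝ) + δ ≤ 1 := fun s hs hs1 => by
    by_contra! hlt
    have hs1' : (s : ℝ) ≤ 1 := s.2.2
    have hs0 : (0 : ℝ) < s := hs.1
    let c : I := ⟨1 - δ, by linarith, by linarith⟩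
    have hcs : c < s := show 1 - δ < s by linarith
    have e1 := h1 s hs1 hcs
    have e2 : dist (Function.leftLim x s) (Function.leftLim x 1) ≤ ε :=
      x.dist_leftLim_le hcs fun u hu => h1 u (hu.2.trans hs1) hu.1
    linarith [dist_triangle_right (Function.leftLim x s) (x s) (Function.leftLim x 1), hs.2]
  let B : I → Prop := fun s => J s ∨ s = 1
  have hB0 : ∀ b, B b → δ ≤ b := by
    rintro b (hb | rfl)
    · exact hJ0 b hb
    · simpa using hδ1
  have hB : ∀ b c, B b → B c → b < c → (b : ℝ) + δ ≤ c := by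
    rintro b c hb hc hbc
    have hb1 : b < 1 := hbc.trans_le unitInterval.le_one'
    have hbJ : J b := hb.resolve_right hb1.ne
    rcases hc with hc | rfl
    · exact add_le_of_lt_jump hw hε hbJ.1 hbc hbJ.2 hc.2
    · simpa using hJ1 b hbJ hb1
  let R : I → I → Prop := fun a b =>
    δ / 4 < (b : ℝ) - a ∧ ∀ s ∈ Ico a b, ∀ u ∈ Ico a b, dist (x s) (x u) ≤ 10 * ε
  have hR : ∀ a b : I, δ / 4 < (b : ℝ) - a → (b : ℝ) ≤ a + δ → (∀ s ∈ Ioo a b, ¬ B s) → R a b :=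
    fun a b hab hab' hn => ⟨hab, dist_le_of_forall_jump_le hε hw hab' fun s hs => by
      by_contra! hlt
      exact hn s hs (Or.inl ⟨unitInterval.nonneg'.trans_lt hs.1, hlt⟩)⟩
  -- Invariant: the next mandatory point is at least `δ / 3` away. If it is within `2δ / 3`, the
  -- step goes to it; otherwise a step of `δ / 3` preserves the invariant. Each step covers at least
  -- `δ / 3`, so `n` of them suffice.
  have key : ∀ (n : ℕ) (s : I), 1 - (s : ℝ) ≤ n * (δ / 3) →
      (∀ b, B b → s < b → (s : ℝ) + δ / 3 ≤ b) → Relation.ReflTransGen R s 1 := by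
    intro n
    induction n with
    | zero =>
      intro s hs _
      have : s = 1 := le_antisymm unitInterval.le_one' (show (1 : ℝ) ≤ s by simpa using hs)
      rw [this]
    | succ n ih =>
      intro s hs hsB
      push_cast at hs
      rcases eq_or_lt_of_le (unitInterval.le_one' (t := s)) with rfl | hs1
      · exact Relation.ReflTransGen.refl
      by_cases hb : ∃ b, B b ∧ s < b ∧ (b : ℝ) ≤ s + 2 * (δ / 3)
      · obtain ⟨b, hb, hsb, hbs⟩ := hb
        have h2 := hsB b hb hsb
        refine Relation.ReflTransGen.head (hR s b (by linarith) (by linarith) fun c hc hcB => ?_)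
          (ih b (by linarith) fun c hc hbc => by linarith [hB b c hb hc hbc])
        have h3 := hB c b hcB hb hc.2
        have h4 : (s : ℝ) < c := hc.1
        linarith
      · push Not at hb
        have h2 : (s : ℝ) + 2 * (δ / 3) < 1 := by simpa using hb 1 (Or.inr rfl) hs1
        have h3 : (0 : ℝ) ≤ s := s.2.1
        let c : I := ⟨s + δ / 3, by linarith, by linarith⟩
        have hc : (c : ℝ) = s + δ / 3 := rfl
        have hsc : s < c := show (s : ℝ) < c by linarith
        refine Relation.ReflTransGen.head (hR s c (by linarith) (by linarith) fun b hb' hbB => ?_)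
          (ih c (by linarith) fun b hbB hcb => by linarith [hb b hbB (hsc.trans hcb)])
        have h4 : (b : ℝ) < c := hb'.2
        linarith [hb b hbB hb'.1]
  obtain ⟨n, hn⟩ := exists_nat_ge (1 / (δ / 3))
  obtain ⟨v, t, ht0, ht1, htR⟩ := (key n 0
    (by simpa using (div_le_iff₀ (by linarith)).1 hn)
    (fun b hb _ => by have := hB0 b hb; simp only [Set.Icc.coe_zero]; linarith)).exists_fin
  refine ⟨v, t, ⟨Fin.strictMono_iff_lt_succ.2 fun i => ?_, ht0, ht1, fun i => (htR i).1⟩,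
    fun i => (htR i).2⟩
  have := (htR i).1
  exact show (t i.castSucc : ℝ) < t i.succ by linarith

end

theorem hasPartition_iff_modulus₂ {A : Set SkorokhodD} :
    (∀ ε : ℝ, 0 < ε → ∃ δ : ℝ, 0 < δ ∧ ∀ x ∈ A, x.HasPartition δ ε) ↔
      (∀ ε : ℝ, 0 < ε → ∃ δ : ℝ, 0 < δ ∧ ∀ x ∈ A, ∀ t₁ t t₂ : I, t₁ ≤ t → t ≤ t₂ →
        (t₂ : ℝ) ≤ t₁ + δ → dist (x t) (x t₁) ≤ ε ∨ dist (x t₂) (x t) ≤ ε) ∧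
      (∀ ε : ℝ, 0 < ε → ∃ δ : ℝ, 0 < δ ∧ ∀ x ∈ A, ∀ s : I, 0 < s → (s : ℝ) < δ →
        dist (x s) (x 0) ≤ ε) ∧
      (∀ ε : ℝ, 0 < ε → ∃ δ : ℝ, 0 < δ ∧ ∀ x ∈ A, ∀ s : I, s < 1 → 1 - δ < (s : ℝ) →
        dist (x s) (Function.leftLim x 1) ≤ ε) := by
  constructor
  · intro h
    refine ⟨fun ε hε => ?_, fun ε hε => ?_, fun ε hε => ?_⟩ <;> obtain ⟨δ, hδ, h⟩ := h ε hε
    · exact ⟨δ, hδ, fun x hx _ _ _ => (h x hx).dist_le_or_dist_le hε.le⟩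
    · exact ⟨δ, hδ, fun x hx _ _ => (h x hx).dist_zero_le⟩
    · exact ⟨δ, hδ, fun x hx _ => (h x hx).dist_leftLim_one_le⟩
  · rintro ⟨hw, h0, h1⟩ ε hε
    -- The divisor offsets the factor 10 lost in `hasPartition_of_modulus₂`.
    have hε' : 0 < ε / 10 := by positivity
    obtain ⟨a, ha, hw⟩ := hw _ hε'
    obtain ⟨b, hb, h0⟩ := h0 _ hε'
    obtain ⟨c, hc, h1⟩ := h1 _ hε'
    obtain ⟨δ, hδ, hδ'⟩ := exists_between (lt_min (lt_min ha hb) (lt_min hc one_pos))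
    simp only [lt_min_iff] at hδ'
    refine ⟨δ / 4, by positivity, fun x hx => ?_⟩
    have := hasPartition_of_modulus₂ (x := x) hδ hδ'.2.2.le hε'
      (fun t₁ t t₂ h2 h3 h4 => hw x hx t₁ t t₂ h2 h3 (by linarith))
      (fun s h2 h3 => h0 x hx s h2 (by linarith)) fun s h2 h3 => h1 x hx s h2 (by linarith)
    rwa [mul_div_cancel₀ ε (by norm_num)] at this

end SkorokhodD

theorem theorem12p3 (A : Set SkorokhodD) :
    (IsRelativelyCompact A ↔
      (⨆ x ∈ A, x.supNorm) < ∞ ∧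
      Tendsto (fun δ : ℝ => ⨆ x ∈ A, x.cadlagModulus δ) (𝓝[>] 0) (𝓝 0)) ∧
    (IsRelativelyCompact A ↔
      (⨆ x ∈ A, x.supNorm) < ∞ ∧
      Tendsto (fun δ : ℝ => ⨆ x ∈ A, x.cadlagModulus₂ δ) (𝓝[>] 0) (𝓝 0) ∧
      Tendsto (fun δ : I => ⨆ x ∈ A, edist (x δ) (x 0)) (𝓝[>] 0) (𝓝 0) ∧
      Tendsto (fun δ : I => ⨆ x ∈ A, edist (Function.leftLim x 1) (x (σ δ))) (𝓝[>] 0) (𝓝 0)) := by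
  rw [SkorokhodD.tendsto_cadlagModulus_iff, SkorokhodD.iSup_supNorm_lt_top_iff,
    SkorokhodD.tendsto_cadlagModulus₂_iff, SkorokhodD.tendsto_edist_zero_iff,
    SkorokhodD.tendsto_edist_leftLim_one_iff, ← SkorokhodD.hasPartition_iff_modulus₂]
  exact ⟨SkorokhodD.isRelativelyCompact_iff_hasPartition,
    SkorokhodD.isRelativelyCompact_iff_hasPartition⟩
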